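/- Let $B\ge 1$ be an integer bin size and let $F$ be a discrete item size distribution: finitely many item types $j=1,\dots,J$ with integer sizes $0<s_1<\dots<s_J<B$ and probabilities $p_j\ge 0$, $\sum_j p_j=1$. Items of i.i.d. types with law $F$ arrive one at a time. The waste of a packing is $W=\sum_{h=1}^{B-1}N_h\,(B-h)$, where here $N_h$ is the number of bins whose items have total size $h$; that is, $W$ is the total unused space in the non-empty bins. Let $W_F^{OPT}(n)$ be the waste of an optimal offline packing of the first $n$ items into bins of size $B$. The online algorithm PD-quad with parameters $\epsilon(t)>0$ may start a new bin above a hole (unusable space) at its bottom. The level of a bin is the size of its hole plus the total size of its items, and $N_h(t)$ denotes the number of bins of level $h$ after $t$ items, with $N_h(0)=0$. When the $t$th item arrives, say of size $s$, PD-quad chooses a level $$h^*\in\mathop{\rm argmin}_{0\le h\le B-s}\Big[B\cdot\mathbf 1_{\{h=B-s\}}-s+\frac{\epsilon(t)}{2}\sum_{k=1}^{B-1}N_k(t)^2\Big],$$ where $N_k(t)$ are the counts that result from sending the item to level $h$: $N_{h+s}(t)=N_{h+s}(t-1)+1$, $N_h(t)=[N_h(t-1)-1]^+$, and all other counts are unchanged.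 It then puts the item into a bin of level $h^*$ if there is one, and otherwise into a new bin, above a hole of size $h^*$. Ties between levels, and the choice among bins of the same level, may be resolved in any way that depends only on the items that have arrived so far. Let $W_F^{PD\text{-}quad}(n)$ be the waste after $n$ items; the holes count as unused space. Theorem. PD-quad with $\epsilon(t)=\dfrac{B^2}{\sqrt{4t}}$, which needs to know neither $F$ nor the horizon $n$, satisfies, for every such distribution $F$ and every $n\ge 0$, $$\mathbb E\big[W_F^{PD\text{-}quad}(n)\big]\le \mathbb E\big[W_F^{OPT}(n)\big]+\sqrt{4B^4n}.$$ -/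

import Mathlib

open MeasureTheory ProbabilityTheory

namespace BinPacking

/-- An item size distribution `F = (U_F, P_F)` for bins of size `B`: finitely many item types, with
distinct positive integer sizes below `B`, listed in increasing order, and a probability for each
type. -/
structure ItemDistribution (B : ℕ) where
  /-- the number of item types -/
  J : ℕ
  /-- the size of an item of each type -/
  size : Fin J → ℕ
  /-- the probability of each type -/
  prob : Fin J → ℝ
  size_strictMono : StrictMono size
  size_pos : ∀ j, 0 < size j
  size_lt : ∀ j, size j < B
  prob_nonneg : ∀ j, 0 ≤ prob j
  prob_sum : ∑ j, prob j = 1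

/-- The waste `∑_{h=1}^{B-1} N_h (B - h)`, where `N_h` is the number of bins whose total content
is `h`. The argument `contents` lists the total content (the sum of the sizes of the items packed)
of each bin. -/
def waste (B : ℕ) (contents : Multiset ℕ) : ℕ :=
  ∑ h ∈ Finset.Icc 1 (B - 1), contents.count h * (B - h)

/-- `Q` is an offline packing of the items `l`: the items are distributed over the bins in `Q`,
and the sizes of the items in each bin sum to at most `B`. -/
def IsOfflinePacking (B : ℕ) (l : List ℕ) (Q : Multiset (Multiset ℕ)) : Prop :=
  (∀ b ∈ Q, b.sum ≤ B) ∧ Q.sum = (l : Multiset ℕ)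

/-- The waste of an optimal offline packing of the items `l`. -/
noncomputable def optWaste (B : ℕ) (l : List ℕ) : ℕ :=
  sInf {w | ∃ Q, IsOfflinePacking B l Q ∧ w = waste B (Q.map Multiset.sum)}

/-- A bin of an online packing: the items in it, above a hole (unusable space) at the bottom. -/
structure Bin where
  hole : ℕ
  items : Multiset ℕ

/-- The total size of the items in a bin. -/
def Bin.content (b : Bin) : ℕ := b.items.sum

/-- The level of a bin as PD-quad sees it: the height up to which it is filled, hole included. -/
def Bin.level (b : Bin) : ℕ := b.hole + b.content

/-- `N_h`: the number of bins of level `h`. -/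
def levelCount (P : Multiset Bin) (h : ℕ) : ℕ := P.countP (fun b => b.level = h)

/-- The level counts after an item of size `s > 0` has been sent to level `h`: `N_{h+s}` goes up by
one, and `N_h` becomes `[N_h - 1]^+`. -/
def countAfter (N : ℕ → ℕ) (s h : ℕ) : ℕ → ℕ := fun k =>
  if k = h + s then N k + 1 else if k = h then N k - 1 else N k

/-- The increment that PD-quad minimizes over `h`:
`B * 1_{h = B - s} - s + (ε / 2) * ∑_{k=1}^{B-1} N_k ^ 2`, with the counts `N_k` after an item of
size `s` has been sent to level `h`. -/
noncomputable def lagrangian (B : ℕ) (ε : ℝ) (N : ℕ → ℕ) (s h : ℕ) : ℝ :=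
  (if h + s = B then (B : ℝ) else 0) - (s : ℝ)
    + ε / 2 * ∑ k ∈ Finset.Icc 1 (B - 1), (countAfter N s h k : ℝ) ^ 2

/-- `h` is a level, `0 ≤ h ≤ B - s`, that minimizes the Lagrangian. -/
def IsBestLevel (B : ℕ) (ε : ℝ) (N : ℕ → ℕ) (s h : ℕ) : Prop :=
  h + s ≤ B ∧ ∀ h', h' + s ≤ B → lagrangian B ε N s h ≤ lagrangian B ε N s h'

/-- `P'` results from the packing `P` by sending an item of size `s` to level `h`: into some bin
of level `h` if there is one, and otherwise into a new bin, above a hole of size `h`. -/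
def SendsTo (P : Multiset Bin) (s h : ℕ) (P' : Multiset Bin) : Prop :=
  (∃ (b : Bin) (R : Multiset Bin), b.level = h ∧ P = b ::ₘ R ∧
      P' = (⟨b.hole, s ::ₘ b.items⟩ : Bin) ::ₘ R) ∨
    ((∀ b ∈ P, b.level ≠ h) ∧ P' = (⟨h, {s}⟩ : Bin) ::ₘ P)

/-- `A` is a version of the online algorithm PD-quad with parameters `ε(1), ε(2), …`, for bins of
size `B`. Here `A l` is the packing after the arrival of items with sizes `l` (in order of arrival),
so that it depends on past arrivals only. It starts without bins and sends each arriving item to a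
level that minimizes the Lagrangian; ties between levels, and the choice among the bins of the
chosen level, are resolved in any way. -/
def IsPDQuad (B : ℕ) (ε : ℕ → ℝ) (A : List ℕ → Multiset Bin) : Prop :=
  A [] = 0 ∧
    ∀ (l : List ℕ) (s : ℕ), (∀ x ∈ l, 0 < x ∧ x < B) → 0 < s → s < B →
      ∃ h, IsBestLevel B (ε (l.length + 1)) (levelCount (A l)) s h ∧
        SendsTo (A l) s h (A (l ++ [s]))

/-- The waste of the online algorithm `A` on the items `l`. Holes count as unused space, because
only the items in a bin are its content. -/
def algWaste (B : ℕ) (A : List ℕ → Multiset Bin) (l : List ℕ) : ℕ :=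
  waste B ((A l).map Bin.content)

/-- The sizes of the first `n` items, when item `i` (counted from `0`) has type `x i`. -/
def firstSizes {B : ℕ} (F : ItemDistribution B) (x : ℕ → Fin F.J) (n : ℕ) : List ℕ :=
  (List.range n).map (fun i => F.size (x i))

end BinPacking

/-!
Write `N_k` for the number of bins of level `k`, `U` for `B * N_B` minus the total size of the
items (`closedCost`), and `Φ` for `∑_{k=1}^{B-1} N_k ^ 2` (`sumSq`). PD-quad chooses the level that
minimizes the increase of `U + ε Φ / 2` (`stepCost`).

The heart of the proof is deterministic (`sum_map_le_optWaste`). Fix arbitrary counts `N`, and let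
`m s` be the least possible increase for an item of size `s`. For every list of `n` items, the sum
of the `m s` is at most the optimal waste of the list plus `n ε`. To see this, push the items of
each bin of an optimal packing to the top of the bin, and compare `m s` with the increase for the
level at which the item then lies. The linear terms add up to the waste of the bin, and the
quadratic ones telescope: an item from level `h` to level `h + s` adds about `2 (N_{h+s} - N_h)` to
`Φ`, the levels `0` and `B` do not enter `Φ`, and the squares of the two unit steps add at most `2`
per item.

Taking for the list `n` random items, and averaging, shows that the expected increase caused by a
single item, given the past, is at most `E[W_OPT(n)] / n + ε` (`mul_sum_prob_mul_le`,
`IsPDQuad.integral_step_le`), because the type of the item is independent of the past.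
Since `ε` is non-increasing, summation by parts (`add_half_mul_le_of_steps`) gives
`E[U(n)] + ε(n) E[Φ(n)] / 2 ≤ E[W_OPT(n)] + ∑ ε(t)`. Finally the waste is `U + B ∑_{k<B} N_k`, and
`B N_k ≤ ε(n) N_k ^ 2 / 2 + √n` (`IsPDQuad.algWaste_le`), so that the excess is at most
`∑ ε(t) + (B - 1) √n ≤ 2 B ^ 2 √n`.
-/

namespace BinPacking

/-! ### Waste of a packing -/

lemma waste_cons (B c : ℕ) (M : Multiset ℕ) :
    waste B (c ::ₘ M) = (if 1 ≤ c ∧ c ≤ B - 1 then B - c else 0) + waste B M := by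
  unfold waste
  simp only [Multiset.count_cons, add_mul, Finset.sum_add_distrib, ite_mul, one_mul, zero_mul,
    Finset.sum_ite_eq', Finset.mem_Icc]
  ring

/-- In `waste`, a non-empty bin contributes its gap, full bins included. -/
lemma cast_gap_eq {B c : ℕ} (h1 : 1 ≤ c) (h2 : c ≤ B) :
    ((if 1 ≤ c ∧ c ≤ B - 1 then B - c else 0 : ℕ) : ℝ) = B - c := by
  rw [← Nat.cast_sub h2]
  congr 1
  split_ifs with h
  · rfl
  · omega

lemma exists_isOfflinePacking_waste_eq (B : ℕ) (l : List ℕ) (hl : ∀ x ∈ l, x ≤ B) :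
    ∃ Q, IsOfflinePacking B l Q ∧ waste B (Q.map Multiset.sum) = optWaste B l := by
  have hne : {w | ∃ Q, IsOfflinePacking B l Q ∧ w = waste B (Q.map Multiset.sum)}.Nonempty := by
    refine ⟨_, (l : Multiset ℕ).map (fun x => {x}), ⟨?_, ?_⟩, rfl⟩
    · intro b hb
      obtain ⟨x, hx, rfl⟩ := Multiset.mem_map.1 hb
      simpa using hl x (by simpa using hx)
    · exact Multiset.sum_map_singleton _
  obtain ⟨Q, hQ, h⟩ := Nat.sInf_mem hne
  exact ⟨Q, hQ, h.symm⟩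

/-! ### Comparison of the Lagrangian with an optimal packing -/

/-- The sum of squared counts over the levels `1, …, B - 1`. -/
def sumSq (B : ℕ) (N : ℕ → ℕ) : ℝ := ∑ k ∈ Finset.Icc 1 (B - 1), (N k : ℝ) ^ 2

lemma sumSq_nonneg (B : ℕ) (N : ℕ → ℕ) : 0 ≤ sumSq B N :=
  Finset.sum_nonneg fun _ _ => sq_nonneg _

/-- The count `N k` as a potential on the levels: levels outside `1, …, B - 1`, which do not enter
the Lagrangian, have potential zero. -/
def potential (B : ℕ) (N : ℕ → ℕ) (k : ℕ) : ℝ := if k ∈ Finset.Icc 1 (B - 1) then (N k : ℝ) else 0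

lemma potential_nonneg (B : ℕ) (N : ℕ → ℕ) (k : ℕ) : 0 ≤ potential B N k := by
  unfold potential; split_ifs <;> simp

/-- Sending an item to level `h` changes the sum of squares by at most twice the difference of the
potentials at its top and at its bottom, plus one for each of these two levels. -/
lemma sumSq_countAfter_le (B : ℕ) (N : ℕ → ℕ) {s : ℕ} (hs : 0 < s) (h : ℕ) :
    sumSq B (countAfter N s h) ≤
      sumSq B N + 2 * (potential B N (h + s) - potential B N h) + 2 := by
  have key : ∀ k ∈ Finset.Icc 1 (B - 1), (countAfter N s h k : ℝ) ^ 2 ≤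
      (N k : ℝ) ^ 2 + (if k = h + s then 2 * (N k : ℝ) + 1 else 0)
        + (if k = h then 1 - 2 * (N k : ℝ) else 0) := by
    intro k _
    unfold countAfter
    by_cases h1 : k = h + s
    · have h2 : k ≠ h := by omega
      simp only [if_pos h1, if_neg h2]; push_cast; linarith
    · by_cases h2 : k = h
      · rw [if_neg h1, if_pos h2, if_neg h1, if_pos h2]
        rcases Nat.eq_zero_or_pos (N k) with h0 | h0
        · simp [h0]
        · rw [Nat.cast_sub h0]; push_cast; linarith
      · simp [h1, h2]
  refine (Finset.sum_le_sum key).trans ?_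
  rw [Finset.sum_add_distrib, Finset.sum_add_distrib, Finset.sum_ite_eq', Finset.sum_ite_eq']
  unfold sumSq potential
  split_ifs <;> linarith

lemma lagrangian_le (B : ℕ) {ε : ℝ} (hε : 0 ≤ ε) (N : ℕ → ℕ) {s : ℕ} (hs : 0 < s) (h : ℕ) :
    lagrangian B ε N s h ≤ (if h + s = B then (B : ℝ) else 0) - s + ε / 2 * sumSq B N
      + ε * (potential B N (h + s) - potential B N h) + ε := by
  have := mul_le_mul_of_nonneg_left (sumSq_countAfter_le B N hs h) (show 0 ≤ ε / 2 by linarith)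
  unfold lagrangian
  change _ - _ + ε / 2 * sumSq B (countAfter N s h) ≤ _
  linarith

/-- Stack the items of a list downwards from level `T`, each item being charged at most the
increase of the Lagrangian for the level at which it lies. The potentials telescope, and
only an item with its top at level `B` pays for a bin. -/
lemma sum_map_le_of_stack {B : ℕ} {ε : ℝ} (hε : 0 ≤ ε) (N : ℕ → ℕ) (m : ℕ → ℝ)
    (hm : ∀ s, 0 < s → s < B → ∀ h, h + s ≤ B →
      m s ≤ lagrangian B ε N s h - ε / 2 * sumSq B N)
    (b : List ℕ) : ∀ T ≤ B, (∀ x ∈ b, 0 < x ∧ x < B) → b.sum ≤ T →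
      (b.map m).sum ≤ (if T = B then (B : ℝ) else 0) - b.sum + ε * potential B N T
        + ε * b.length := by
  induction b with
  | nil =>
    intro T hT _ _
    have := mul_nonneg hε (potential_nonneg B N T)
    have h2 : (0 : ℝ) ≤ if T = B then (B : ℝ) else 0 := by split_ifs <;> simp
    simp only [List.map_nil, List.sum_nil, Nat.cast_zero, List.length_nil]
    linarith
  | cons a b ih =>
    intro T hT hb hsum
    obtain ⟨ha, haB⟩ := hb a (by simp)
    rw [List.sum_cons] at hsum
    have e : T - a + a = T := by omega
    have h1 := hm a ha haB (T - a) (by omega)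
    have h2 := lagrangian_le B hε N ha (T - a)
    rw [e] at h2
    have h3 := ih (T - a) (by omega) (fun x hx => hb x (by simp [hx])) (by omega)
    rw [if_neg (show T - a ≠ B by omega)] at h3
    simp only [List.map_cons, List.sum_cons, List.length_cons, Nat.cast_add, Nat.cast_one]
    linarith

/-- Items charged at most the cheapest increase of the Lagrangian pay in total at most the optimal
waste and `ε` per item, whatever the counts `N` are. -/
lemma sum_map_le_optWaste {B : ℕ} {ε : ℝ} (hε : 0 ≤ ε) (N : ℕ → ℕ) (m : ℕ → ℝ)
    (hm : ∀ s, 0 < s → s < B → ∀ h, h + s ≤ B →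
      m s ≤ lagrangian B ε N s h - ε / 2 * sumSq B N)
    (l : List ℕ) (hl : ∀ x ∈ l, 0 < x ∧ x < B) :
    (l.map m).sum ≤ optWaste B l + ε * l.length := by
  -- Pushing the items to the top makes a non-empty bin pay `B` exactly once.
  have bin : ∀ b : Multiset ℕ, (∀ x ∈ b, 0 < x ∧ x < B) → b.sum ≤ B →
      (b.map m).sum ≤ ((if 1 ≤ b.sum ∧ b.sum ≤ B - 1 then B - b.sum else 0 : ℕ) : ℝ)
        + ε * b.card := by
    intro b hb hsum
    obtain ⟨b, rfl⟩ : ∃ l : List ℕ, (l : Multiset ℕ) = b := ⟨_, b.coe_toList⟩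
    rcases b with _ | ⟨a, b⟩
    · simp
    have ha := hb a (by simp)
    have h1 := sum_map_le_of_stack hε N m hm (a :: b) B le_rfl (by simpa using hb)
      (by simpa using hsum)
    have hB : potential B N B = 0 := by
      unfold potential
      rw [if_neg]
      simp only [Finset.mem_Icc]; omega
    rw [cast_gap_eq (by simp; omega) hsum, Multiset.map_coe, Multiset.sum_coe, Multiset.sum_coe,
      Multiset.coe_card]
    rw [hB, if_pos rfl] at h1
    linarith
  have packing : ∀ Q : Multiset (Multiset ℕ), (∀ b ∈ Q, b.sum ≤ B) →
      (∀ b ∈ Q, ∀ x ∈ b, 0 < x ∧ x < B) →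
      (Q.sum.map m).sum ≤ (waste B (Q.map Multiset.sum) : ℝ) + ε * Q.sum.card := by
    intro Q
    induction Q using Multiset.induction_on with
    | empty => intro _ _; simp
    | cons b Q ih =>
      intro h1 h2
      have i1 := ih (fun b hb => h1 b (by simp [hb])) (fun b hb => h2 b (by simp [hb]))
      have i2 := bin b (h2 b (by simp)) (h1 b (by simp))
      rw [Multiset.map_cons, waste_cons, Multiset.sum_cons, Multiset.map_add, Multiset.sum_add,
        Multiset.card_add]
      push_cast at *
      linarith
  obtain ⟨Q, ⟨hQ1, hQ2⟩, hQ⟩ :=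
    exists_isOfflinePacking_waste_eq B l (fun x hx => (hl x hx).2.le)
  have := packing Q hQ1 (fun b hb x hx => hl x (by
    rw [← Multiset.mem_coe, ← hQ2]
    exact Multiset.mem_of_le (Multiset.single_le_sum (fun _ _ => Multiset.zero_le _) b hb) hx))
  rw [hQ, hQ2] at this
  simpa using this

/-! ### The bins of PD-quad -/

lemma SendsTo.levelCount_eq {P P' : Multiset Bin} {s h : ℕ} (hs : 0 < s) (H : SendsTo P s h P') :
    levelCount P' = countAfter (levelCount P) s h := by
  funext k
  rcases H with ⟨b, R, hb, rfl, rfl⟩ | ⟨hP, rfl⟩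
  · have hl : (⟨b.hole, s ::ₘ b.items⟩ : Bin).level = h + s := by
      rw [← hb]; simp only [Bin.level, Bin.content, Multiset.sum_cons]; omega
    unfold countAfter levelCount
    simp only [Multiset.countP_cons, hl, hb]
    split_ifs <;> omega
  · have hl : (⟨h, {s}⟩ : Bin).level = h + s := by
      simp [Bin.level, Bin.content]
    have h0 : P.countP (fun b => b.level = h) = 0 := Multiset.countP_eq_zero.2 hP
    unfold countAfter levelCount
    simp only [Multiset.countP_cons, hl]
    split_ifs <;> first | omega | (subst_vars; omega)

/-- Every bin in the packing is non-empty and is filled to level at most `B`. -/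
def IsValid (B : ℕ) (P : Multiset Bin) : Prop := ∀ b ∈ P, 1 ≤ b.content ∧ b.level ≤ B

lemma SendsTo.isValid {B : ℕ} {P P' : Multiset Bin} {s h : ℕ} (hs : 0 < s) (hB : h + s ≤ B)
    (H : SendsTo P s h P') (hP : IsValid B P) : IsValid B P' := by
  rcases H with ⟨b, R, hb, rfl, rfl⟩ | ⟨_, rfl⟩
  · intro c hc
    rcases Multiset.mem_cons.1 hc with rfl | hc
    · simp only [Bin.level, Bin.content, Multiset.sum_cons] at *
      omega
    · exact hP c (by simp [hc])
  · intro c hc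
    rcases Multiset.mem_cons.1 hc with rfl | hc
    · simp only [Bin.level, Bin.content, Multiset.sum_singleton]
      omega
    · exact hP c hc

lemma SendsTo.sum_content {P P' : Multiset Bin} {s h : ℕ} (H : SendsTo P s h P') :
    (P'.map Bin.content).sum = (P.map Bin.content).sum + s := by
  rcases H with ⟨b, R, hb, rfl, rfl⟩ | ⟨_, rfl⟩
  · simp only [Multiset.map_cons, Multiset.sum_cons, Bin.content]; omega
  · simp only [Multiset.map_cons, Multiset.sum_cons, Bin.content, Multiset.sum_singleton]; omega

lemma IsPDQuad.isValid_and_sum_content {B : ℕ} {ε : ℕ → ℝ} {A : List ℕ → Multiset Bin}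
    (hA : IsPDQuad B ε A) (l : List ℕ) (hl : ∀ x ∈ l, 0 < x ∧ x < B) :
    IsValid B (A l) ∧ ((A l).map Bin.content).sum = l.sum := by
  induction l using List.reverseRecOn with
  | nil => rw [hA.1]; simp [IsValid]
  | append_singleton l s ih =>
    have hl' : ∀ x ∈ l, 0 < x ∧ x < B := fun x hx => hl x (by simp [hx])
    obtain ⟨hs, hsB⟩ := hl s (by simp)
    obtain ⟨h, hbest, hsend⟩ := hA.2 l s hl' hs hsB
    obtain ⟨h1, h2⟩ := ih hl'
    exact ⟨hsend.isValid hs hbest.1 h1, by rw [hsend.sum_content, h2]; simp⟩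

/-- The waste is `B` times the number of bins, counted by level, minus the total content. -/
lemma IsValid.waste_eq {B : ℕ} {P : Multiset Bin} (hP : IsValid B P) :
    (waste B (P.map Bin.content) : ℝ) = B * levelCount P B - (P.map Bin.content).sum
      + ∑ k ∈ Finset.Icc 1 (B - 1), (B : ℝ) * levelCount P k := by
  induction P using Multiset.induction_on with
  | empty => simp [waste, levelCount]
  | cons b P ih =>
    have ih := ih (fun c hc => hP c (by simp [hc]))
    obtain ⟨h1, h2⟩ := hP b (by simp)
    have hc : b.content ≤ b.level := by simp [Bin.level]
    have e2 : (∑ k ∈ Finset.Icc 1 (B - 1), (B : ℝ) * levelCount (b ::ₘ P) k)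
        = (∑ k ∈ Finset.Icc 1 (B - 1), (B : ℝ) * levelCount P k)
          + if b.level = B then 0 else (B : ℝ) := by
      simp only [levelCount, Multiset.countP_cons, Nat.cast_add, mul_add, Finset.sum_add_distrib,
        Nat.cast_ite, Nat.cast_one, Nat.cast_zero, mul_ite, mul_one, mul_zero, Finset.sum_ite_eq,
        Finset.mem_Icc]
      congr 1
      split_ifs <;> first | rfl | omega
    have e3 : (levelCount (b ::ₘ P) B : ℝ) = levelCount P B + if b.level = B then 1 else 0 := by
      simp [levelCount, Multiset.countP_cons]
    rw [Multiset.map_cons, waste_cons, Multiset.sum_cons, e2, e3]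
    push_cast [cast_gap_eq h1 (hc.trans h2)] at *
    rw [ih]
    split_ifs <;> ring

/-- The cost of the bins of level `B`, minus the total size of the items. This is the part of the
waste which the linear terms of the Lagrangian account for. -/
noncomputable def closedCost (B : ℕ) (A : List ℕ → Multiset Bin) (l : List ℕ) : ℝ :=
  B * levelCount (A l) B - l.sum

/-- The increase of the closed cost and of `ε / 2` times the sum of squares as an item of size `s`
arrives after the items `l`. -/
noncomputable def stepCost (B : ℕ) (ε : ℝ) (A : List ℕ → Multiset Bin) (l : List ℕ) (s : ℕ) : ℝ :=
  closedCost B A (l ++ [s]) - closedCost B A l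
    + ε / 2 * (sumSq B (levelCount (A (l ++ [s]))) - sumSq B (levelCount (A l)))

lemma IsPDQuad.stepCost_le {B : ℕ} {ε : ℕ → ℝ} {A : List ℕ → Multiset Bin}
    (hA : IsPDQuad B ε A) {l : List ℕ} (hl : ∀ x ∈ l, 0 < x ∧ x < B) (s : ℕ) (hs : 0 < s)
    (hsB : s < B) (h : ℕ) (hh : h + s ≤ B) :
    stepCost B (ε (l.length + 1)) A l s ≤ lagrangian B (ε (l.length + 1)) (levelCount (A l)) s h
      - ε (l.length + 1) / 2 * sumSq B (levelCount (A l)) := by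
  obtain ⟨g, hbest, hsend⟩ := hA.2 l s hl hs hsB
  have hc := hsend.levelCount_eq hs
  have e : stepCost B (ε (l.length + 1)) A l s
      = lagrangian B (ε (l.length + 1)) (levelCount (A l)) s g
        - ε (l.length + 1) / 2 * sumSq B (levelCount (A l)) := by
    have hB : (levelCount (A (l ++ [s])) B : ℝ)
        = levelCount (A l) B + if g + s = B then 1 else 0 := by
      rw [hc]
      unfold countAfter
      have := hbest.1
      split_ifs <;> first | omega | simp
    unfold stepCost closedCost lagrangian
    rw [hB, hc]
    simp only [List.sum_append, List.sum_singleton, sumSq]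
    push_cast
    split_ifs <;> ring
  rw [e]
  linarith [hbest.2 h hh]

/-- The bins below level `B` are paid for by the quadratic term: `B x ≤ ε x² / 2 + B² / (2 ε)`,
where `ε = B² / (2 r)`. -/
lemma IsPDQuad.algWaste_le {B : ℕ} {ε : ℕ → ℝ} {A : List ℕ → Multiset Bin}
    (hA : IsPDQuad B ε A) {l : List ℕ} (hl : ∀ x ∈ l, 0 < x ∧ x < B) {r : ℝ} (hr : 0 < r) :
    (algWaste B A l : ℝ) ≤ closedCost B A l
      + (B : ℝ) ^ 2 / (2 * r) / 2 * sumSq B (levelCount (A l)) + (B - 1 : ℕ) * r := by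
  obtain ⟨hv, hsum⟩ := hA.isValid_and_sum_content l hl
  have key : ∀ k ∈ Finset.Icc 1 (B - 1), (B : ℝ) * levelCount (A l) k
      ≤ (B : ℝ) ^ 2 / (2 * r) / 2 * (levelCount (A l) k : ℝ) ^ 2 + r := by
    intro k _
    have : (B : ℝ) ^ 2 / (2 * r) / 2 * (levelCount (A l) k : ℝ) ^ 2 + r
        - (B : ℝ) * levelCount (A l) k = ((B : ℝ) * levelCount (A l) k / 2 - r) ^ 2 / r := by
      field_simp
      ring
    have h2 : 0 ≤ ((B : ℝ) * levelCount (A l) k / 2 - r) ^ 2 / r := by positivity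
    linarith
  have h1 := Finset.sum_le_sum key
  rw [Finset.sum_add_distrib, ← Finset.mul_sum (a := (B : ℝ) ^ 2 / (2 * r) / 2),
    Finset.sum_const, Nat.card_Icc, Nat.add_sub_cancel, nsmul_eq_mul] at h1
  unfold algWaste closedCost
  rw [hv.waste_eq, hsum]
  unfold sumSq
  linarith

/-! ### Expectations over the arrival sequence -/

section Expectation

variable {B : ℕ} (F : ItemDistribution B) {Ω : Type*} [MeasurableSpace Ω]

lemma firstSizes_succ (x : ℕ → Fin F.J) (n : ℕ) :
    firstSizes F x (n + 1) = firstSizes F x n ++ [F.size (x n)] := by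
  simp [firstSizes, List.range_succ]

lemma mem_firstSizes (x : ℕ → Fin F.J) (n : ℕ) : ∀ y ∈ firstSizes F x n, 0 < y ∧ y < B := by
  intro y hy
  obtain ⟨i, _, rfl⟩ := List.mem_map.1 hy
  exact ⟨F.size_pos _, F.size_lt _⟩

/-- The first `n` sizes are a function of the tuple of the first `n` types, a random variable with
values in a finite discrete space. -/
lemma exists_comp_firstSizes (n : ℕ) : ∃ G : (Finset.range n → Fin F.J) → List ℕ,
    ∀ x : ℕ → Fin F.J, firstSizes F x n = G (fun i => x i) := by
  refine ⟨fun y => (List.range n).pmap (fun i hi => F.size (y ⟨i, hi⟩)) (fun i hi => by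
    simpa using hi), fun x => ?_⟩
  simp [firstSizes, List.pmap_eq_map]

variable {F} {μ : Measure Ω} {X : ℕ → Ω → Fin F.J}

lemma integrable_firstSizes [IsFiniteMeasure μ] (hX_meas : ∀ i, Measurable (X i)) (n : ℕ)
    (f : List ℕ → ℝ) : Integrable (fun ω => f (firstSizes F (fun i => X i ω) n)) μ := by
  obtain ⟨G, hG⟩ := exists_comp_firstSizes F n
  simp only [hG]
  have hm : Measurable (fun ω => fun i : Finset.range n => X i ω) :=
    measurable_pi_lambda _ fun i => hX_meas i
  exact (Integrable.of_finite (μ := μ.map _) (f := fun y => f (G y))).comp_measurable hm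

lemma integral_type (hX_meas : ∀ i, Measurable (X i))
    [IsProbabilityMeasure μ] (hX_law : ∀ i j, μ.real {ω | X i ω = j} = F.prob j) (i : ℕ)
    (m : Fin F.J → ℝ) : ∫ ω, m (X i ω) ∂μ = ∑ j, F.prob j * m j := by
  rw [← integral_map (hX_meas i).aemeasurable
    (measurable_of_finite m).aestronglyMeasurable, integral_fintype Integrable.of_finite]
  refine Finset.sum_congr rfl fun j _ => ?_
  rw [map_measureReal_apply (hX_meas i) (measurableSet_singleton j), smul_eq_mul, ← hX_law i j]
  rfl

/-- The type of the next item is independent of the sizes that have arrived. -/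
lemma integral_firstSizes_type (hX_meas : ∀ i, Measurable (X i)) (hX_indep : iIndepFun X μ)
    [IsProbabilityMeasure μ] (hX_law : ∀ i j, μ.real {ω | X i ω = j} = F.prob j) (n : ℕ)
    (g : List ℕ → Fin F.J → ℝ) :
    ∫ ω, g (firstSizes F (fun i => X i ω) n) (X n ω) ∂μ
      = ∫ ω, ∑ j, F.prob j * g (firstSizes F (fun i => X i ω) n) j ∂μ := by
  have hind : ∀ j, IndepFun (fun ω => g (firstSizes F (fun i => X i ω) n) j)
      (fun ω => if X n ω = j then (1 : ℝ) else 0) μ := by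
    intro j
    obtain ⟨G, hG⟩ := exists_comp_firstSizes F n
    simp only [hG]
    have h := hX_indep.indepFun_finset (Finset.range n) {n} (by simp) hX_meas
    exact h.comp (φ := fun y => g (G y) j)
      (ψ := fun y => if y ⟨n, Finset.mem_singleton_self n⟩ = j then (1 : ℝ) else 0)
      (measurable_of_finite _) (measurable_of_finite _)
  have hexp : ∀ ω, g (firstSizes F (fun i => X i ω) n) (X n ω)
      = ∑ j, g (firstSizes F (fun i => X i ω) n) j * (if X n ω = j then (1 : ℝ) else 0) := by
    intro ω; simp
  have hmeas : ∀ j, Measurable (fun ω => if X n ω = j then (1 : ℝ) else 0) := fun j =>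
    (measurable_of_finite (fun y : Fin F.J => if y = j then (1 : ℝ) else 0)).comp (hX_meas n)
  have hint := fun j => integrable_firstSizes hX_meas n (μ := μ) (fun l => g l j)
  simp only [hexp]
  rw [integral_finsetSum, integral_finsetSum]
  · refine Finset.sum_congr rfl fun j _ => ?_
    rw [(hind j).integral_fun_mul_eq_mul_integral (hint j).aestronglyMeasurable
      (hmeas j).aestronglyMeasurable,
      integral_type hX_meas hX_law n (fun y => if y = j then (1 : ℝ) else 0), integral_const_mul]
    simp [mul_comm]
  · exact fun j _ => (hint j).const_mul _
  · exact fun j _ => (hint j).mul_bdd (c := 1) (hmeas j).aestronglyMeasurable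
      (ae_of_all _ fun ω => by split_ifs <;> simp)

lemma integral_sum_map_firstSizes (hX_meas : ∀ i, Measurable (X i))
    [IsProbabilityMeasure μ] (hX_law : ∀ i j, μ.real {ω | X i ω = j} = F.prob j) (n : ℕ)
    (m : ℕ → ℝ) :
    ∫ ω, ((firstSizes F (fun i => X i ω) n).map m).sum ∂μ
      = n * ∑ j, F.prob j * m (F.size j) := by
  induction n with
  | zero => simp [firstSizes]
  | succ n ih =>
    simp only [firstSizes_succ, List.map_append, List.sum_append, List.map_singleton,
      List.sum_singleton]
    rw [integral_add (integrable_firstSizes hX_meas n (fun l => (l.map m).sum)), ih,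
      integral_type hX_meas hX_law n (fun j => m (F.size j))]
    · push_cast; ring
    · exact (Integrable.of_finite (μ := μ.map (X n)) (f := fun y => m (F.size y))).comp_measurable
        (hX_meas n)

/-- The charges `m` average, over the type of a single item, to at most a fraction `1 / n` of the
optimal waste of `n` fresh items, plus `ε`. -/
lemma mul_sum_prob_mul_le (hX_meas : ∀ i, Measurable (X i))
    [IsProbabilityMeasure μ] (hX_law : ∀ i j, μ.real {ω | X i ω = j} = F.prob j) (n : ℕ)
    {ε : ℝ} (hε : 0 ≤ ε) (N : ℕ → ℕ) (m : ℕ → ℝ)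
    (hm : ∀ s, 0 < s → s < B → ∀ h, h + s ≤ B →
      m s ≤ lagrangian B ε N s h - ε / 2 * sumSq B N) :
    n * ∑ j, F.prob j * m (F.size j)
      ≤ ∫ ω, (optWaste B (firstSizes F (fun i => X i ω) n) : ℝ) ∂μ + n * ε := by
  rw [← integral_sum_map_firstSizes hX_meas hX_law n m]
  have hI := integrable_firstSizes (μ := μ) hX_meas n (fun l => (optWaste B l : ℝ))
  have h : ∫ ω, ((optWaste B (firstSizes F (fun i => X i ω) n) : ℝ) + n * ε) ∂μ
      = ∫ ω, (optWaste B (firstSizes F (fun i => X i ω) n) : ℝ) ∂μ + n * ε := by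
    rw [integral_add hI (integrable_const _)]; simp
  rw [← h]
  refine integral_mono (integrable_firstSizes hX_meas n (fun l => (l.map m).sum))
    (hI.add (integrable_const _)) fun ω => ?_
  have := sum_map_le_optWaste hε N m hm _ (mem_firstSizes F (fun i => X i ω) n)
  have hlen : (firstSizes F (fun i => X i ω) n).length = n := by simp [firstSizes]
  rw [hlen] at this
  simpa [mul_comm] using this

/-- The expected increase at the arrival of item `t + 1` is at most `E[W_OPT(n)] / n + ε(t + 1)`,
for every `n`. -/
lemma IsPDQuad.integral_step_le {ε : ℕ → ℝ} {A : List ℕ → Multiset Bin} (hA : IsPDQuad B ε A)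
    (hX_meas : ∀ i, Measurable (X i)) (hX_indep : iIndepFun X μ)
    [IsProbabilityMeasure μ] (hX_law : ∀ i j, μ.real {ω | X i ω = j} = F.prob j) (n t : ℕ)
    (hε : 0 ≤ ε (t + 1)) :
    n * (∫ ω, closedCost B A (firstSizes F (fun i => X i ω) (t + 1)) ∂μ
        - ∫ ω, closedCost B A (firstSizes F (fun i => X i ω) t) ∂μ
        + ε (t + 1) / 2 *
          (∫ ω, sumSq B (levelCount (A (firstSizes F (fun i => X i ω) (t + 1)))) ∂μ
            - ∫ ω, sumSq B (levelCount (A (firstSizes F (fun i => X i ω) t))) ∂μ))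
      ≤ ∫ ω, (optWaste B (firstSizes F (fun i => X i ω) n) : ℝ) ∂μ + n * ε (t + 1) := by
  have hU := fun k => integrable_firstSizes (μ := μ) hX_meas k (closedCost B A)
  have hS := fun k => integrable_firstSizes (μ := μ) hX_meas k
    (fun l => sumSq B (levelCount (A l)))
  have e : ∫ ω, stepCost B (ε (t + 1)) A (firstSizes F (fun i => X i ω) t) (F.size (X t ω)) ∂μ
      = ∫ ω, closedCost B A (firstSizes F (fun i => X i ω) (t + 1)) ∂μ
        - ∫ ω, closedCost B A (firstSizes F (fun i => X i ω) t) ∂μ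
        + ε (t + 1) / 2 *
          (∫ ω, sumSq B (levelCount (A (firstSizes F (fun i => X i ω) (t + 1)))) ∂μ
            - ∫ ω, sumSq B (levelCount (A (firstSizes F (fun i => X i ω) t))) ∂μ) := by
    rw [← integral_sub (hU _) (hU _), ← integral_sub (hS _) (hS _), ← integral_const_mul]
    simp only [stepCost, ← firstSizes_succ F (fun i => X i _)]
    exact integral_add ((hU _).sub (hU _)) (((hS _).sub (hS _)).const_mul _)
  rw [← e, integral_firstSizes_type hX_meas hX_indep hX_law t
    (fun l j => stepCost B (ε (t + 1)) A l (F.size j)), ← integral_const_mul]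
  set W := ∫ ω, (optWaste B (firstSizes F (fun i => X i ω) n) : ℝ) ∂μ
  have hc : W + n * ε (t + 1) = ∫ _, (W + n * ε (t + 1)) ∂μ := by simp
  rw [hc]
  refine integral_mono (integrable_firstSizes hX_meas t (fun l =>
    n * ∑ j, F.prob j * stepCost B (ε (t + 1)) A l (F.size j))) (integrable_const _) fun ω => ?_
  refine mul_sum_prob_mul_le hX_meas hX_law n hε
    (levelCount (A (firstSizes F (fun i => X i ω) t))) _ fun s hs hsB h hh => ?_
  have := hA.stepCost_le (mem_firstSizes F (fun i => X i ω) t) s hs hsB h hh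
  have hlen : (firstSizes F (fun i => X i ω) t).length = t := by simp [firstSizes]
  rwa [hlen] at this

end Expectation

/-! ### Summation over time -/

/-- Summation by parts for a non-increasing `ε`: the weights `ε t` of the increments of `b` may be
replaced by the last one, because `b` is nonnegative. -/
lemma add_half_mul_le_of_steps {a b ε : ℕ → ℝ} {w : ℝ} (ha : a 0 = 0) (hb0 : b 0 = 0)
    (hb : ∀ t, 0 ≤ b t) (hε : ∀ t, ε (t + 2) ≤ ε (t + 1))
    (h : ∀ t, a (t + 1) - a t + ε (t + 1) / 2 * (b (t + 1) - b t) ≤ w + ε (t + 1)) (n : ℕ) :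
    a n + ε n / 2 * b n ≤ n * w + ∑ t ∈ Finset.range n, ε (t + 1) := by
  induction n with
  | zero => simp [ha, hb0]
  | succ n ih =>
    -- Nothing is assumed about `ε 0`: its coefficient is `b 0 = 0`.
    have h1 : ε (n + 1) * b n ≤ ε n * b n := by
      rcases n with _ | n
      · simp [hb0]
      · exact mul_le_mul_of_nonneg_right (hε n) (hb _)
    rw [Finset.sum_range_succ]
    push_cast
    linarith [h n]

lemma sqrt_four_mul (x : ℝ) : Real.sqrt (4 * x) = 2 * Real.sqrt x := by
  rw [Real.sqrt_mul (by norm_num), show (4 : ℝ) = 2 ^ 2 by norm_num, Real.sqrt_sq (by norm_num)]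

lemma sum_div_sqrt_le {c : ℝ} (hc : 0 ≤ c) (n : ℕ) :
    ∑ t ∈ Finset.range n, c / Real.sqrt (4 * ((t + 1 : ℕ) : ℝ)) ≤ c * Real.sqrt n := by
  induction n with
  | zero => simp
  | succ n ih =>
    rw [Finset.sum_range_succ, sqrt_four_mul]
    have hp : 0 < Real.sqrt ((n + 1 : ℕ) : ℝ) := Real.sqrt_pos.2 (by positivity)
    have h1 : Real.sqrt ((n + 1 : ℕ) : ℝ) ^ 2 = n + 1 := by
      rw [Real.sq_sqrt (by positivity)]; push_cast; ring
    have h2 : Real.sqrt (n : ℝ) ^ 2 = n := Real.sq_sqrt (by positivity)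
    have h3 : 1 / (2 * Real.sqrt ((n + 1 : ℕ) : ℝ))
        ≤ Real.sqrt ((n + 1 : ℕ) : ℝ) - Real.sqrt n := by
      rw [div_le_iff₀ (by positivity)]
      nlinarith [sq_nonneg (Real.sqrt ((n + 1 : ℕ) : ℝ) - Real.sqrt n)]
    have h4 := mul_le_mul_of_nonneg_left h3 hc
    rw [mul_one_div] at h4
    linarith

end BinPacking

theorem theorem2 (B : ℕ) (A : List ℕ → Multiset BinPacking.Bin)
    (hA : BinPacking.IsPDQuad B (fun t => (B : ℝ) ^ 2 / Real.sqrt (4 * (t : ℝ))) A)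
    (F : BinPacking.ItemDistribution B)
    {Ω : Type*} [MeasurableSpace Ω] (μ : Measure Ω) [IsProbabilityMeasure μ]
    (X : ℕ → Ω → Fin F.J) (hX_meas : ∀ i, Measurable (X i)) (hX_indep : iIndepFun X μ)
    (hX_law : ∀ i j, μ.real {ω | X i ω = j} = F.prob j) (n : ℕ) :
    ∫ ω, (BinPacking.algWaste B A (BinPacking.firstSizes F (fun i => X i ω) n) : ℝ) ∂μ
      ≤ ∫ ω, (BinPacking.optWaste B (BinPacking.firstSizes F (fun i => X i ω) n) : ℝ) ∂μ
        + Real.sqrt (4 * (B : ℝ) ^ 4 * (n : ℝ)) := by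
  open BinPacking in
  rcases Nat.eq_zero_or_pos n with rfl | hn
  · simp [firstSizes, algWaste, waste, hA.1]
  have hn' : (0 : ℝ) < n := by exact_mod_cast hn
  have hr : 0 < Real.sqrt n := Real.sqrt_pos.2 hn'
  set W := ∫ ω, (optWaste B (firstSizes F (fun i => X i ω) n) : ℝ) ∂μ with hW
  set ε : ℕ → ℝ := fun t => (B : ℝ) ^ 2 / Real.sqrt (4 * (t : ℝ)) with hεdef
  have hε : ∀ t, 0 ≤ ε t := fun t => by positivity
  have hεn : ε n = (B : ℝ) ^ 2 / (2 * Real.sqrt n) := by simp only [hεdef, sqrt_four_mul]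
  have hanti : ∀ t, ε (t + 2) ≤ ε (t + 1) := fun t => by
    have : 0 < Real.sqrt (4 * ((t + 1 : ℕ) : ℝ)) := Real.sqrt_pos.2 (by positivity)
    refine div_le_div_of_nonneg_left (by positivity) this (Real.sqrt_le_sqrt ?_)
    push_cast
    linarith
  have hsteps := add_half_mul_le_of_steps (w := W / n) (ε := ε)
    (a := fun t => ∫ ω, closedCost B A (firstSizes F (fun i => X i ω) t) ∂μ)
    (b := fun t => ∫ ω, sumSq B (levelCount (A (firstSizes F (fun i => X i ω) t))) ∂μ)
    (by simp [firstSizes, closedCost, hA.1, levelCount])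
    (by simp [firstSizes, hA.1, levelCount, sumSq])
    (fun t => integral_nonneg fun ω => sumSq_nonneg _ _) hanti
    (fun t => by
      have := hA.integral_step_le hX_meas hX_indep hX_law n t (hε _)
      refine le_of_mul_le_mul_left (this.trans_eq ?_) hn'
      rw [← hW]
      field_simp) n
  have hsum := sum_div_sqrt_le (c := (B : ℝ) ^ 2) (by positivity) n
  have hU := integrable_firstSizes (μ := μ) hX_meas n (closedCost B A)
  have hS := integrable_firstSizes (μ := μ) hX_meas n (fun l => sumSq B (levelCount (A l)))
  have hfinal : ∫ ω, (algWaste B A (firstSizes F (fun i => X i ω) n) : ℝ) ∂μ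
      ≤ ∫ ω, closedCost B A (firstSizes F (fun i => X i ω) n) ∂μ
        + ε n / 2 * ∫ ω, sumSq B (levelCount (A (firstSizes F (fun i => X i ω) n))) ∂μ
        + (B - 1 : ℕ) * Real.sqrt n := by
    have e : ∫ ω, (closedCost B A (firstSizes F (fun i => X i ω) n)
        + ε n / 2 * sumSq B (levelCount (A (firstSizes F (fun i => X i ω) n)))
        + (B - 1 : ℕ) * Real.sqrt n) ∂μ = _ :=
      integral_add (hU.add (hS.const_mul _)) (integrable_const _)
    rw [← integral_const_mul, ← integral_add hU (hS.const_mul _)]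
    simp only [integral_const, probReal_univ, one_smul] at e
    refine le_trans ?_ e.le
    refine integral_mono (integrable_firstSizes hX_meas n (fun l => (algWaste B A l : ℝ)))
      ((hU.add (hS.const_mul _)).add (integrable_const _)) fun ω => ?_
    rw [hεn]
    exact hA.algWaste_le (mem_firstSizes F (fun i => X i ω) n) hr
  have hB : ((B - 1 : ℕ) : ℝ) ≤ (B : ℝ) ^ 2 := by
    exact_mod_cast (Nat.sub_le B 1).trans (Nat.le_self_pow two_ne_zero B)
  have hroot : Real.sqrt (4 * (B : ℝ) ^ 4 * (n : ℝ)) = 2 * (B : ℝ) ^ 2 * Real.sqrt n := by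
    rw [show 4 * (B : ℝ) ^ 4 * (n : ℝ) = (2 * (B : ℝ) ^ 2) ^ 2 * n by ring,
      Real.sqrt_mul (by positivity), Real.sqrt_sq (by positivity)]
  have hmean : (n : ℝ) * (W / n) = W := by field_simp
  rw [hmean] at hsteps
  rw [hroot]
  have := mul_le_mul_of_nonneg_right hB hr.le
  simp only [hεdef] at hsteps hfinal hsum
  linarith
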